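/- Let $\Gamma_n=\{P\in\mathbb R^n: p_i\ge 0,\ \sum_i p_i=1\}$ and $\Gamma_n^+=\{P\in\Gamma_n: p_i>0 \text{ for all } i\}$. Let $G:\Gamma_n\to\mathbb R$ be convex on $\Gamma_n$ and differentiable on $\Gamma_n^+$ (as a function on the simplex). The Bregman divergence generated by $G$ is $$D^G(P;Q)=G(P)-G(Q)-\langle\nabla G(Q),P-Q\rangle\in[0,+\infty],\qquad P,Q\in\Gamma_n,$$ where, for $Q$ on the boundary of $\Gamma_n$, $\langle\nabla G(Q),P-Q\rangle$ is read as the one-sided directional derivative $\lim_{t\downarrow0}\bigl(G(Q+t(P-Q))-G(Q)\bigr)/t\in[-\infty,\infty)$, which for $Q\in\Gamma_n^+$ equals the inner product. A function $D:\Gamma_n\times\Gamma_n\to[0,+\infty]$ satisfies Sufficiency if $D(P;Q)\ge D(PW;QW)$ for all $P,Q\in\Gamma_n$ and every stochastic $n\times n$ matrix $W$ which is a sufficient transformation for $(P,Q)$, meaning: if $Z\in\{1,2\}$ takes both values with positive probability, $X$ has conditional law $P$ given $Z=1$ and $Q$ given $Z=2$, and $Y$ is obtained from $X$ through the channel $W$,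 then $Z-X-Y$ and $Z-Y-X$ are both Markov chains. (Here $(PW)_y=\sum_x p_xW(y|x)$ is the law of the output.) 1. If $n\ge3$ and $D^G$ satisfies Sufficiency, then there is a constant $c\ge0$ with $D^G(P;Q)=c\,D_{\mathrm{KL}}(P;Q)$ for all $P,Q\in\Gamma_n$, where $D_{\mathrm{KL}}(P;Q)=\sum_i p_i\ln(p_i/q_i)$, with $0\ln 0=0$, with value $+\infty$ if $p_i>0=q_i$ for some $i$, and $0\cdot\infty=0$. ($D^G$ is not assumed to be decomposable.) 2. If $n=2$, then $D^G$ satisfies Sufficiency if and only if it is generated by a symmetric function, i.e. there is a convex $S:\Gamma_2\to\mathbb R$, differentiable on $\Gamma_2^+$, with $S(p_1,p_2)=S(p_2,p_1)$ on $\Gamma_2$, such that $D^G(P;Q)=D^S(P;Q)$ for all $P,Q\in\Gamma_2$. -/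

import Mathlib

open Set Filter Topology

/-- The probability simplex `Γ_n`: probability vectors on an alphabet with `n` letters. -/
abbrev probSimplex (n : ℕ) : Set (Fin n → ℝ) := stdSimplex ℝ (Fin n)

/-- The relative interior `Γ_n⁺` of the simplex: all probabilities are positive. -/
def probSimplexPos (n : ℕ) : Set (Fin n → ℝ) := {P | P ∈ probSimplex n ∧ ∀ i, 0 < P i}

/-! ### Sufficient transformations -/

/-- `A - B - C` is a Markov chain under the joint mass function `μ` on `α × β × γ`:
`A` and `C` are conditionally independent given `B`, i.e.
`μ(a,b,c) μ(b) = μ(a,b) μ(b,c)` for all `a, b, c`. -/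
def IsMarkovChain {α β γ : Type} [Fintype α] [Fintype β] [Fintype γ]
    (μ : α → β → γ → ℝ) : Prop :=
  ∀ a b c, μ a b c * (∑ a', ∑ c', μ a' b c') = (∑ c', μ a b c') * (∑ a', μ a' b c)

/-- The joint mass function of `(Z, X, Y)`, where `Z ∈ {1, 2}` has law `w`, the conditional laws
of `X` given `Z = 1` and `Z = 2` are `P` and `Q`, and `Y` is produced from `X` by the channel `W`
(so `W x y` is the conditional probability of `Y = y` given `X = x`). -/
def jointZXY {n : ℕ} (w : Fin 2 → ℝ) (P Q : Fin n → ℝ) (W : Matrix (Fin n) (Fin n) ℝ)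
    (z : Fin 2) (x y : Fin n) : ℝ :=
  w z * (![P, Q] z) x * W x y

/-- The channel `W` is a sufficient transformation of `X` for `Z`: both `Z - X - Y` and
`Z - Y - X` are Markov chains. -/
def IsSufficientTransformation {n : ℕ} (w : Fin 2 → ℝ) (P Q : Fin n → ℝ)
    (W : Matrix (Fin n) (Fin n) ℝ) : Prop :=
  IsMarkovChain (fun z x y => jointZXY w P Q W z x y) ∧
    IsMarkovChain (fun z y x => jointZXY w P Q W z x y)

/-- The sufficiency property of a divergence function on `Γ_n`. The law `w` of `Z` charges both
values of `Z`, so that the conditional laws given `Z` are meaningful; `Matrix.vecMul P W` is the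
output law of the channel `W` (a row-stochastic matrix) with input law `P`. -/
def SatisfiesSufficiency (n : ℕ) (D : (Fin n → ℝ) → (Fin n → ℝ) → EReal) : Prop :=
  ∀ P ∈ probSimplex n, ∀ Q ∈ probSimplex n, ∀ w ∈ probSimplexPos 2,
    ∀ W ∈ Matrix.rowStochastic ℝ (Fin n), IsSufficientTransformation w P Q W →
      D (Matrix.vecMul P W) (Matrix.vecMul Q W) ≤ D P Q

/-! ### Bregman divergences -/

/-- `G` generates a Bregman divergence on `Γ_n`: it is convex on `Γ_n` and differentiable on
`Γ_n⁺` (as a function on the simplex; values of `G` off the simplex play no role). -/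
structure IsBregmanGenerator (n : ℕ) (G : (Fin n → ℝ) → ℝ) : Prop where
  convexOn : ConvexOn ℝ (probSimplex n) G
  differentiable : ∀ Q ∈ probSimplexPos n, DifferentiableWithinAt ℝ G (probSimplex n) Q

/-- The one-sided directional derivative of `G` at `Q` in the direction `P - Q`, with values in
the extended reals. For convex `G` the difference quotients do converge as `t ↓ 0`
(`tendsto_dirDeriv`), so the upper limit below is a limit; it is `⟨∇G(Q), P - Q⟩` at every point
`Q` where `G` is differentiable, and it may be `-∞` at boundary points `Q`. -/
noncomputable def dirDeriv {n : ℕ} (G : (Fin n → ℝ) → ℝ) (Q P : Fin n → ℝ) : EReal :=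
  limsup (fun t : ℝ => (((G (Q + t • (P - Q)) - G Q) / t : ℝ) : EReal)) (𝓝[>] 0)

/-- The Bregman divergence `D^G(P;Q) = G(P) - G(Q) - ⟨∇G(Q), P - Q⟩` generated by `G`, on all of
`Γ_n × Γ_n`; see `bregman_eq` for the points where `G` is differentiable. -/
noncomputable def bregman {n : ℕ} (G : (Fin n → ℝ) → ℝ) (P Q : Fin n → ℝ) : EReal :=
  ((G P - G Q : ℝ) : EReal) - dirDeriv G Q P

/-- `G` is a symmetric function on `Γ_n`: invariant under permutations of the coordinates. -/
def IsSymmetricOnSimplex (n : ℕ) (G : (Fin n → ℝ) → ℝ) : Prop :=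
  ∀ σ : Equiv.Perm (Fin n), ∀ P ∈ probSimplex n, G (P ∘ σ) = G P

/-- Kullback-Leibler divergence `∑ p_i ln (p_i / q_i)`, which is `+∞` unless `P ≪ Q`
(with `0 ln 0 = 0`). -/
noncomputable def klDivergence {n : ℕ} (P Q : Fin n → ℝ) : EReal :=
  open Classical in
  if ∀ i, Q i = 0 → P i = 0 then ((∑ i, P i * Real.log (P i / Q i) : ℝ) : EReal) else ⊤

/-! ### Consistency of the definitions -/

theorem tendsto_dirDeriv {n : ℕ} {G : (Fin n → ℝ) → ℝ} (hG : ConvexOn ℝ (probSimplex n) G)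
    {P Q : Fin n → ℝ} (hP : P ∈ probSimplex n) (hQ : Q ∈ probSimplex n) :
    Tendsto (fun t : ℝ => (((G (Q + t • (P - Q)) - G Q) / t : ℝ) : EReal)) (𝓝[>] 0)
      (𝓝 (dirDeriv G Q P)) := by
  set f : ℝ → EReal := fun t => (((G (Q + t • (P - Q)) - G Q) / t : ℝ) : EReal) with hf
  have hmem : ∀ t ∈ Icc (0 : ℝ) 1, Q + t • (P - Q) ∈ probSimplex n := by
    intro t ht
    exact (convex_stdSimplex ℝ (Fin n)).add_smul_sub_mem hQ hP ht
  have hmono : MonotoneOn f (Ioc 0 1) := by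
    intro s hs t ht hst
    simp only [hf, EReal.coe_le_coe_iff]
    rw [div_le_div_iff₀ hs.1 ht.1]
    have hst' : s / t ≤ 1 := (div_le_one ht.1).2 hst
    have h := hG.2 hQ (hmem t ⟨ht.1.le, ht.2⟩) (show (0 : ℝ) ≤ 1 - s / t by linarith)
      (div_nonneg hs.1.le ht.1.le) (by ring)
    have he : (1 - s / t) • Q + (s / t) • (Q + t • (P - Q)) = Q + s • (P - Q) := by
      ext i
      have := ht.1.ne'
      simp only [Pi.add_apply, Pi.smul_apply, Pi.sub_apply, smul_eq_mul]
      field_simp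
      ring
    rw [he] at h
    simp only [smul_eq_mul] at h
    have h2 := mul_le_mul_of_nonneg_right h ht.1.le
    have h3 : ((1 - s / t) * G Q + s / t * G (Q + t • (P - Q))) * t
        = (t - s) * G Q + s * G (Q + t • (P - Q)) := by
      have := ht.1.ne'
      field_simp
    rw [h3] at h2
    nlinarith
  have hlim : Tendsto f (𝓝[>] 0) (𝓝 (sInf (f '' Ioo 0 1))) :=
    (hmono.mono Ioo_subset_Ioc_self).tendsto_nhdsWithin_Ioo_right (by simp) (OrderBot.bddBelow _)
  have : dirDeriv G Q P = sInf (f '' Ioo 0 1) := hlim.limsup_eq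
  rw [this]
  exact hlim

theorem bregman_eq {n : ℕ} {G : (Fin n → ℝ) → ℝ} {P Q : Fin n → ℝ} {G' : (Fin n → ℝ) →L[ℝ] ℝ}
    (hP : P ∈ probSimplex n) (hQ : Q ∈ probSimplex n)
    (hG : HasFDerivWithinAt G G' (probSimplex n) Q) :
    bregman G P Q = ((G P - G Q - G' (P - Q) : ℝ) : EReal) := by
  have hlim : Tendsto (fun t : ℝ => (G (Q + t • (P - Q)) - G Q) / t) (𝓝[>] 0)
      (𝓝 (G' (P - Q))) := by
    have hc : HasDerivWithinAt (fun t : ℝ => Q + t • (P - Q)) (P - Q) (Icc 0 1) 0 := by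
      have := ((hasDerivAt_id (0 : ℝ)).smul_const (P - Q)).const_add Q
      simpa using this.hasDerivWithinAt
    have hmaps : MapsTo (fun t : ℝ => Q + t • (P - Q)) (Icc 0 1) (probSimplex n) :=
      fun t ht => (convex_stdSimplex ℝ (Fin n)).add_smul_sub_mem hQ hP ht
    have hG0 : HasFDerivWithinAt G G' (probSimplex n) (Q + (0 : ℝ) • (P - Q)) := by simpa using hG
    have h := (hG0.comp_hasDerivWithinAt (0 : ℝ) hc hmaps).mono Ioc_subset_Icc_self
    rw [hasDerivWithinAt_iff_tendsto_slope' (by simp)] at h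
    rw [← nhdsWithin_Ioc_eq_nhdsGT (zero_lt_one (α := ℝ))]
    refine h.congr fun t => ?_
    simp [slope_def_field]
  have : dirDeriv G Q P = ((G' (P - Q) : ℝ) : EReal) :=
    ((continuous_coe_real_ereal.tendsto _).comp hlim).limsup_eq
  rw [bregman, this, ← EReal.coe_sub]

/-- The law on the alphabet `Fin n` with probability vector `P`, as a measure. -/
noncomputable def lawOf {n : ℕ} (P : Fin n → ℝ) : MeasureTheory.Measure (Fin n) :=
  ∑ i, ENNReal.ofReal (P i) • MeasureTheory.Measure.dirac i

theorem lawOf_singleton {n : ℕ} (P : Fin n → ℝ) (i : Fin n) :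
    lawOf P {i} = ENNReal.ofReal (P i) := by
  simp only [lawOf, MeasureTheory.Measure.finsetSum_apply, MeasureTheory.Measure.smul_apply,
    MeasureTheory.Measure.dirac_apply, smul_eq_mul]
  rw [Finset.sum_eq_single i] <;> simp +contextual [Set.indicator]

/-- The finite formula agrees with the Kullback-Leibler divergence of measures. -/
theorem klDivergence_eq_klDiv {n : ℕ} {P Q : Fin n → ℝ}
    (hP : P ∈ probSimplex n) (hQ : Q ∈ probSimplex n) :
    klDivergence P Q = (InformationTheory.klDiv (lawOf P) (lawOf Q) : EReal) := by
  have hprob : ∀ {R : Fin n → ℝ}, R ∈ probSimplex n →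
      MeasureTheory.IsProbabilityMeasure (lawOf R) := by
    intro R hR
    constructor
    simp only [lawOf, MeasureTheory.Measure.finsetSum_apply, MeasureTheory.Measure.smul_apply,
      MeasureTheory.measure_univ, smul_eq_mul, mul_one]
    rw [← ENNReal.ofReal_sum_of_nonneg fun i _ => hR.1 i, hR.2, ENNReal.ofReal_one]
  have := hprob hP
  have := hprob hQ
  have hac : (lawOf P).AbsolutelyContinuous (lawOf Q) ↔ ∀ i, Q i = 0 → P i = 0 := by
    constructor
    · intro h i hi
      have := h (s := {i}) (by simp [lawOf_singleton, hi])
      rw [lawOf_singleton, ENNReal.ofReal_eq_zero] at this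
      exact le_antisymm this (hP.1 i)
    · intro h s hs
      rw [← Set.biUnion_of_singleton s, MeasureTheory.measure_biUnion_null_iff s.to_countable]
      intro i hi
      have hi0 : lawOf Q {i} = 0 :=
        MeasureTheory.measure_mono_null (Set.singleton_subset_iff.2 hi) hs
      rw [lawOf_singleton, ENNReal.ofReal_eq_zero] at hi0 ⊢
      exact (h i (le_antisymm hi0 (hQ.1 i))).le
  by_cases h : ∀ i, Q i = 0 → P i = 0
  · have hμν := hac.2 h
    have hint : MeasureTheory.Integrable (MeasureTheory.llr (lawOf P) (lawOf Q)) (lawOf P) :=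
      MeasureTheory.Integrable.of_finite
    have hrn : ∀ i, P i ≠ 0 → (lawOf P).rnDeriv (lawOf Q) i = ENNReal.ofReal (P i / Q i) := by
      intro i hi
      have hQi : 0 < Q i := lt_of_le_of_ne (hQ.1 i) fun h0 => hi (h i h0.symm)
      have h1 := MeasureTheory.Measure.setLIntegral_rnDeriv hμν {i}
      rw [MeasureTheory.lintegral_singleton, lawOf_singleton, lawOf_singleton] at h1
      rw [ENNReal.ofReal_div_of_pos hQi, ← h1, ENNReal.mul_div_cancel_right] <;> simp [hQi]
    have hsum : ∫ x, MeasureTheory.llr (lawOf P) (lawOf Q) x ∂(lawOf P)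
        = ∑ i, P i * Real.log (P i / Q i) := by
      rw [MeasureTheory.integral_fintype hint]
      refine Finset.sum_congr rfl fun i _ => ?_
      rw [MeasureTheory.measureReal_def, lawOf_singleton, ENNReal.toReal_ofReal (hP.1 i),
        smul_eq_mul]
      by_cases hi : P i = 0
      · simp [hi]
      · rw [MeasureTheory.llr, hrn i hi,
          ENNReal.toReal_ofReal (div_nonneg (hP.1 i) (hQ.1 i))]
    have hnn := InformationTheory.integral_llr_add_sub_measure_univ_nonneg hμν hint
    rw [klDivergence, if_pos h, InformationTheory.klDiv_of_ac_of_integrable hμν hint, hsum]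
    rw [hsum] at hnn
    simp only [MeasureTheory.probReal_univ, add_sub_cancel_right] at hnn ⊢
    rw [EReal.coe_ennreal_ofReal, max_eq_left hnn]
  · rw [klDivergence, if_neg h, InformationTheory.klDiv_of_not_ac fun h' => h (hac.1 h'),
      EReal.coe_ennreal_top]

/-- A row-stochastic channel is a sufficient transformation for `(P, Q)` exactly when the posterior
laws of the input given the output agree under `P` and `Q`. -/
theorem isSufficientTransformation_iff {n : ℕ} {w : Fin 2 → ℝ} (hw : w ∈ probSimplexPos 2)
    {P Q : Fin n → ℝ} {W : Matrix (Fin n) (Fin n) ℝ} (hW : W ∈ Matrix.rowStochastic ℝ (Fin n)) :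
    IsSufficientTransformation w P Q W ↔
      ∀ x y, P x * W x y * Matrix.vecMul Q W y = Q x * W x y * Matrix.vecMul P W y := by
  have hsum := (Matrix.mem_rowStochastic_iff_sum.1 hW).2
  have h0 := hw.2 0
  have h1 := hw.2 1
  have hvec : ∀ (c : ℝ) (R : Fin n → ℝ) (y : Fin n),
      ∑ x, c * R x * W x y = c * Matrix.vecMul R W y := by
    intro c R y
    simp only [Matrix.vecMul, dotProduct, Finset.mul_sum, mul_assoc]
  constructor
  · intro h x y
    have h2 := h.2 0 y x
    simp only [jointZXY, Fin.sum_univ_two, Matrix.cons_val_zero, Matrix.cons_val_one,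
      hvec] at h2
    have : w 0 * w 1 ≠ 0 := (mul_pos h0 h1).ne'
    apply mul_left_cancel₀ this
    linear_combination h2
  · intro h
    constructor
    · intro z x y
      simp only [jointZXY, ← Finset.mul_sum, hsum, Fin.sum_univ_two, mul_one]
      ring
    · intro z y x
      have := h x y
      fin_cases z
      · simp only [jointZXY, Fin.sum_univ_two, Matrix.cons_val_zero, Matrix.cons_val_one, hvec,
          Fin.zero_eta]
        linear_combination (w 0 * w 1) * this
      · simp only [jointZXY, Fin.sum_univ_two, Matrix.cons_val_zero, Matrix.cons_val_one, hvec,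
          Fin.mk_one]
        linear_combination (-w 0 * w 1) * this

theorem SatisfiesSufficiency.le_of_posterior {n : ℕ} {D : (Fin n → ℝ) → (Fin n → ℝ) → EReal}
    (hD : SatisfiesSufficiency n D) {P Q : Fin n → ℝ} (hP : P ∈ probSimplex n)
    (hQ : Q ∈ probSimplex n) {W : Matrix (Fin n) (Fin n) ℝ}
    (hW : W ∈ Matrix.rowStochastic ℝ (Fin n))
    (h : ∀ x y, P x * W x y * Matrix.vecMul Q W y = Q x * W x y * Matrix.vecMul P W y) :
    D (Matrix.vecMul P W) (Matrix.vecMul Q W) ≤ D P Q := by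
  have hw : (fun _ => 1 / 2 : Fin 2 → ℝ) ∈ probSimplexPos 2 := by
    refine ⟨⟨fun i => by norm_num, by norm_num⟩, fun i => by norm_num⟩
  exact hD P hP Q hQ _ hw W hW ((isSufficientTransformation_iff hw hW).2 h)

theorem bregman_self {n : ℕ} (G : (Fin n → ℝ) → ℝ) (P : Fin n → ℝ) : bregman G P P = 0 := by
  simp [bregman, dirDeriv]

theorem dirDeriv_le {n : ℕ} {G : (Fin n → ℝ) → ℝ} (hG : ConvexOn ℝ (probSimplex n) G)
    {P Q : Fin n → ℝ} (hP : P ∈ probSimplex n) (hQ : Q ∈ probSimplex n) :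
    dirDeriv G Q P ≤ ((G P - G Q : ℝ) : EReal) := by
  refine le_of_tendsto (tendsto_dirDeriv hG hP hQ) ?_
  filter_upwards [Ioc_mem_nhdsGT (zero_lt_one (α := ℝ))] with t ht
  rw [EReal.coe_le_coe_iff, div_le_iff₀ ht.1]
  have h := hG.2 hQ hP (sub_nonneg.2 ht.2) ht.1.le (by ring)
  have he : (1 - t) • Q + t • P = Q + t • (P - Q) := by
    ext i; simp; ring
  rw [he] at h
  simp only [smul_eq_mul] at h
  linarith

theorem bregman_nonneg {n : ℕ} {G : (Fin n → ℝ) → ℝ} (hG : ConvexOn ℝ (probSimplex n) G)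
    {P Q : Fin n → ℝ} (hP : P ∈ probSimplex n) (hQ : Q ∈ probSimplex n) :
    0 ≤ bregman G P Q := by
  rw [bregman]
  exact (EReal.sub_nonneg (.inl (EReal.coe_ne_top _)) (.inl (EReal.coe_ne_bot _))).2 (dirDeriv_le hG hP hQ)

/-- The difference quotients converge to a real number once the divergence is finite. -/
theorem tendsto_quotient_of_bregman_eq {n : ℕ} {G : (Fin n → ℝ) → ℝ}
    (hG : ConvexOn ℝ (probSimplex n) G) {P Q : Fin n → ℝ} (hP : P ∈ probSimplex n)
    (hQ : Q ∈ probSimplex n) {d : ℝ} (hd : bregman G P Q = d) :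
    Tendsto (fun t : ℝ => (G (Q + t • (P - Q)) - G Q) / t) (𝓝[>] 0) (𝓝 (G P - G Q - d)) := by
  have h := tendsto_dirDeriv hG hP hQ
  have : dirDeriv G Q P = ((G P - G Q - d : ℝ) : EReal) := by
    rw [bregman] at hd
    generalize dirDeriv G Q P = e at hd ⊢
    induction e with
    | bot => rw [EReal.coe_sub_bot] at hd; exact absurd hd.symm (EReal.coe_ne_top d)
    | top => rw [EReal.sub_top] at hd; exact absurd hd.symm (EReal.coe_ne_bot d)
    | coe x =>
      rw [← EReal.coe_sub, EReal.coe_eq_coe_iff] at hd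
      rw [EReal.coe_eq_coe_iff]; linarith
  rw [this] at h
  exact EReal.tendsto_coe.1 h

theorem bregman_eq_of_tendsto {n : ℕ} {G : (Fin n → ℝ) → ℝ} {P Q : Fin n → ℝ} {d : ℝ}
    (h : Tendsto (fun t : ℝ => (G (Q + t • (P - Q)) - G Q) / t) (𝓝[>] 0) (𝓝 d)) :
    bregman G P Q = ((G P - G Q - d : ℝ) : EReal) := by
  have : dirDeriv G Q P = (d : EReal) := (EReal.tendsto_coe.2 h).limsup_eq
  rw [bregman, this, ← EReal.coe_sub]

theorem bregman_eq_top_of_tendsto {n : ℕ} {G : (Fin n → ℝ) → ℝ} {P Q : Fin n → ℝ}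
    (h : Tendsto (fun t : ℝ => (G (Q + t • (P - Q)) - G Q) / t) (𝓝[>] 0) atBot) :
    bregman G P Q = ⊤ := by
  have : dirDeriv G Q P = ⊥ := (EReal.tendsto_coe_nhds_bot_iff.2 h).limsup_eq
  rw [bregman, this, EReal.coe_sub_bot]

theorem tendsto_quotient_of_bregman_eq_top {n : ℕ} {G : (Fin n → ℝ) → ℝ}
    (hG : ConvexOn ℝ (probSimplex n) G) {P Q : Fin n → ℝ} (hP : P ∈ probSimplex n)
    (hQ : Q ∈ probSimplex n) (hd : bregman G P Q = ⊤) :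
    Tendsto (fun t : ℝ => (G (Q + t • (P - Q)) - G Q) / t) (𝓝[>] 0) atBot := by
  have h := tendsto_dirDeriv hG hP hQ
  have : dirDeriv G Q P = ⊥ := by
    rw [bregman] at hd
    generalize dirDeriv G Q P = e at hd ⊢
    induction e with
    | bot => rfl
    | top => rw [EReal.sub_top] at hd; exact absurd hd bot_ne_top
    | coe x => exact absurd hd (by rw [← EReal.coe_sub]; exact EReal.coe_ne_top _)
  rw [this] at h
  exact EReal.tendsto_coe_nhds_bot_iff.1 h

theorem vecMul_mem_probSimplex {n : ℕ} {W : Matrix (Fin n) (Fin n) ℝ}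
    (hW : W ∈ Matrix.rowStochastic ℝ (Fin n)) {P : Fin n → ℝ} (hP : P ∈ probSimplex n) :
    Matrix.vecMul P W ∈ probSimplex n := by
  refine ⟨fun j => Matrix.nonneg_vecMul_of_mem_rowStochastic hW hP.1 j, ?_⟩
  simp only [Matrix.vecMul, dotProduct]
  rw [Finset.sum_comm]
  simp only [← Finset.mul_sum, Matrix.sum_row_of_mem_rowStochastic hW, mul_one, hP.2]

theorem vecMul_permMatrix_swap (P : Fin 2 → ℝ) :
    Matrix.vecMul P !![0, 1; 1, 0] = P ∘ Equiv.swap 0 1 := by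
  ext i
  fin_cases i <;> simp [Matrix.vecMul, dotProduct, Fin.sum_univ_two]

theorem comp_perm_mem_probSimplex {n : ℕ} (σ : Equiv.Perm (Fin n)) {P : Fin n → ℝ}
    (hP : P ∈ probSimplex n) : P ∘ σ ∈ probSimplex n :=
  ⟨fun i => hP.1 _, by simpa [Equiv.sum_comp σ P] using hP.2⟩

theorem comp_perm_segment {n : ℕ} (σ : Equiv.Perm (Fin n)) (P Q : Fin n → ℝ) (t : ℝ) :
    (Q ∘ σ) + t • (P ∘ σ - Q ∘ σ) = (Q + t • (P - Q)) ∘ σ := rfl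

theorem bregman_comp_perm {n : ℕ} {S : (Fin n → ℝ) → ℝ} (hS : IsSymmetricOnSimplex n S)
    (σ : Equiv.Perm (Fin n)) {P Q : Fin n → ℝ} (hP : P ∈ probSimplex n) (hQ : Q ∈ probSimplex n) :
    bregman S (P ∘ σ) (Q ∘ σ) = bregman S P Q := by
  rw [bregman, bregman, dirDeriv, dirDeriv, hS σ P hP, hS σ Q hQ]
  congr 1
  apply limsup_congr
  filter_upwards [Ioc_mem_nhdsGT (zero_lt_one (α := ℝ))] with t ht
  rw [comp_perm_segment, hS σ _ ((convex_stdSimplex ℝ (Fin n)).add_smul_sub_mem hQ hP ⟨ht.1.le, ht.2⟩)]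

/-- On a binary alphabet, a sufficient transformation for distinct laws is a relabelling. -/
theorem binary_channel_of_posterior {P Q : Fin 2 → ℝ} (hP : P ∈ probSimplex 2)
    (hQ : Q ∈ probSimplex 2) (hPQ : P ≠ Q) {W : Matrix (Fin 2) (Fin 2) ℝ}
    (hW : W ∈ Matrix.rowStochastic ℝ (Fin 2))
    (h : ∀ x y, P x * W x y * Matrix.vecMul Q W y = Q x * W x y * Matrix.vecMul P W y) :
    W = 1 ∨ W = !![0, 1; 1, 0] := by
  obtain ⟨hnn, hsum⟩ := Matrix.mem_rowStochastic_iff_sum.1 hW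
  have hPs := hP.2
  have hQs := hQ.2
  simp only [Fin.sum_univ_two] at hsum hPs hQs
  have key : ∀ y, W 0 y = 0 ∨ W 1 y = 0 := by
    intro y
    by_contra! hne
    have h0 : 0 < W 0 y := lt_of_le_of_ne (hnn 0 y) hne.1.symm
    have h1 : 0 < W 1 y := lt_of_le_of_ne (hnn 1 y) hne.2.symm
    have e0 : P 0 * Matrix.vecMul Q W y = Q 0 * Matrix.vecMul P W y := by
      apply mul_left_cancel₀ hne.1; linear_combination h 0 y
    have e1 : P 1 * Matrix.vecMul Q W y = Q 1 * Matrix.vecMul P W y := by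
      apply mul_left_cancel₀ hne.2; linear_combination h 1 y
    have e2 : Matrix.vecMul Q W y = Matrix.vecMul P W y := by
      linear_combination e0 + e1 - Matrix.vecMul Q W y * hPs + Matrix.vecMul P W y * hQs
    have hpos : 0 < Matrix.vecMul P W y := by
      simp only [Matrix.vecMul, dotProduct, Fin.sum_univ_two]
      rcases (hP.1 0).eq_or_lt with h | h
      · have : P 1 = 1 := by linarith
        rw [← h, this]; simpa using h1
      · have := mul_pos h h0
        have := mul_nonneg (hP.1 1) h1.le
        linarith
    rw [e2] at e0 e1
    apply hPQ
    ext i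
    fin_cases i
    · exact mul_right_cancel₀ hpos.ne' e0
    · exact mul_right_cancel₀ hpos.ne' e1
  have s0 := hsum 0
  have s1 := hsum 1
  rcases key 0 with h0 | h0
  · right
    have h01 : W 0 1 = 1 := by linarith
    have h11 : W 1 1 = 0 := (key 1).resolve_left (by rw [h01]; exact one_ne_zero)
    ext i j
    fin_cases i <;> fin_cases j <;> simp [h0, h01, h11]
    linarith
  · left
    have h11 : W 1 1 = 1 := by linarith
    have h01 : W 0 1 = 0 := (key 1).resolve_right (by rw [h11]; exact one_ne_zero)
    ext i j
    fin_cases i <;> fin_cases j <;> simp [h0, h01, h11]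
    linarith

theorem satisfiesSufficiency_of_symmetric {S : (Fin 2 → ℝ) → ℝ}
    (hconv : ConvexOn ℝ (probSimplex 2) S) (hS : IsSymmetricOnSimplex 2 S) :
    SatisfiesSufficiency 2 (bregman S) := by
  intro P hP Q hQ w hw W hW hsuff
  by_cases hPQ : P = Q
  · subst hPQ
    rw [bregman_self]
    exact bregman_nonneg hconv hP hP
  · rcases binary_channel_of_posterior hP hQ hPQ hW
      ((isSufficientTransformation_iff hw hW).1 hsuff) with rfl | rfl
    · simp
    · rw [vecMul_permMatrix_swap, vecMul_permMatrix_swap, bregman_comp_perm hS _ hP hQ]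

theorem SatisfiesSufficiency.swap {D : (Fin 2 → ℝ) → (Fin 2 → ℝ) → EReal}
    (hD : SatisfiesSufficiency 2 D) {P Q : Fin 2 → ℝ} (hP : P ∈ probSimplex 2)
    (hQ : Q ∈ probSimplex 2) :
    D (P ∘ Equiv.swap 0 1) (Q ∘ Equiv.swap 0 1) = D P Q := by
  have hle : ∀ P ∈ probSimplex 2, ∀ Q ∈ probSimplex 2,
      D (P ∘ Equiv.swap 0 1) (Q ∘ Equiv.swap 0 1) ≤ D P Q := by
    intro P hP Q hQ
    rw [← vecMul_permMatrix_swap, ← vecMul_permMatrix_swap]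
    refine hD.le_of_posterior hP hQ (Matrix.mem_rowStochastic_iff_sum.2 ⟨?_, ?_⟩) ?_
    · intro i j; fin_cases i <;> fin_cases j <;> simp
    · intro i; fin_cases i <;> simp
    · intro x y
      rw [vecMul_permMatrix_swap, vecMul_permMatrix_swap]
      fin_cases x <;> fin_cases y <;> simp <;> ring
  refine le_antisymm (hle P hP Q hQ) ?_
  have hinv : ∀ R : Fin 2 → ℝ, (R ∘ Equiv.swap 0 1) ∘ Equiv.swap 0 1 = R := by
    intro R; ext i; simp
  simpa only [hinv] using hle _ (comp_perm_mem_probSimplex (Equiv.swap 0 1) hP) _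
    (comp_perm_mem_probSimplex (Equiv.swap 0 1) hQ)

/-- The average of `G` over the two labellings of a binary alphabet. -/
noncomputable def binarySymmetrization (G : (Fin 2 → ℝ) → ℝ) (P : Fin 2 → ℝ) : ℝ :=
  (G P + G (P ∘ Equiv.swap 0 1)) / 2

theorem isSymmetricOnSimplex_binarySymmetrization (G : (Fin 2 → ℝ) → ℝ) :
    IsSymmetricOnSimplex 2 (binarySymmetrization G) := by
  intro σ P _
  have hσ : σ = 1 ∨ σ = Equiv.swap 0 1 := by
    revert σ; decide
  rcases hσ with rfl | rfl
  · rfl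
  · have : (P ∘ Equiv.swap 0 1) ∘ Equiv.swap 0 1 = P := by ext i; simp
    rw [binarySymmetrization, binarySymmetrization, this, add_comm]

theorem isBregmanGenerator_binarySymmetrization {G : (Fin 2 → ℝ) → ℝ}
    (hG : IsBregmanGenerator 2 G) : IsBregmanGenerator 2 (binarySymmetrization G) := by
  let τ : (Fin 2 → ℝ) →L[ℝ] (Fin 2 → ℝ) :=
    ContinuousLinearMap.pi fun i => ContinuousLinearMap.proj (Equiv.swap 0 1 i)
  have hτ : ∀ P, τ P = P ∘ Equiv.swap 0 1 := fun P => rfl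
  constructor
  · refine ⟨convex_stdSimplex ℝ _, ?_⟩
    intro P hP Q hQ a b ha hb hab
    have h1 := hG.convexOn.2 hP hQ ha hb hab
    have h2 := hG.convexOn.2 (comp_perm_mem_probSimplex (Equiv.swap 0 1) hP)
      (comp_perm_mem_probSimplex (Equiv.swap 0 1) hQ) ha hb hab
    have he : (a • P + b • Q) ∘ Equiv.swap 0 1
      = a • (P ∘ Equiv.swap 0 1) + b • (Q ∘ Equiv.swap 0 1) := rfl
    simp only [binarySymmetrization, smul_eq_mul, he] at *
    linarith
  · intro Q hQ
    have hQ' : τ Q ∈ probSimplexPos 2 :=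
      ⟨comp_perm_mem_probSimplex (Equiv.swap 0 1) hQ.1, fun i => hQ.2 _⟩
    have h := (hG.differentiable _ hQ').comp Q
      τ.differentiableAt.differentiableWithinAt
      (fun R hR => comp_perm_mem_probSimplex (Equiv.swap 0 1) hR)
    exact ((hG.differentiable Q hQ).add h).mul_const (2 : ℝ)⁻¹

theorem bregman_binarySymmetrization {G : (Fin 2 → ℝ) → ℝ} (hG : ConvexOn ℝ (probSimplex 2) G)
    (hD : SatisfiesSufficiency 2 (bregman G)) {P Q : Fin 2 → ℝ} (hP : P ∈ probSimplex 2)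
    (hQ : Q ∈ probSimplex 2) : bregman G P Q = bregman (binarySymmetrization G) P Q := by
  have hsw := hD.swap hP hQ
  have hP' := comp_perm_mem_probSimplex (Equiv.swap 0 1) hP
  have hQ' := comp_perm_mem_probSimplex (Equiv.swap 0 1) hQ
  have hnn := bregman_nonneg hG hP hQ
  have hquot : (fun t : ℝ => (binarySymmetrization G (Q + t • (P - Q))
      - binarySymmetrization G Q) / t)
      = fun t => (((G (Q + t • (P - Q)) - G Q) / t)
        + ((G (Q ∘ Equiv.swap 0 1 + t • (P ∘ Equiv.swap 0 1 - Q ∘ Equiv.swap 0 1))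
          - G (Q ∘ Equiv.swap 0 1)) / t)) / 2 := by
    ext t
    rw [comp_perm_segment, binarySymmetrization, binarySymmetrization]
    ring
  rcases eq_or_ne (bregman G P Q) ⊤ with htop | htop
  · rw [htop, bregman_eq_top_of_tendsto]
    rw [hquot]
    exact ((tendsto_quotient_of_bregman_eq_top hG hP hQ htop).atBot_add_atBot
      (tendsto_quotient_of_bregman_eq_top hG hP' hQ' (hsw.trans htop))).atBot_div_const two_pos
  · obtain ⟨d, hd⟩ : ∃ d : ℝ, bregman G P Q = d :=
      ⟨_, (EReal.coe_toReal htop (ne_of_gt (lt_of_lt_of_le (by simp) hnn))).symm⟩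
    have h := ((tendsto_quotient_of_bregman_eq hG hP hQ hd).add
      (tendsto_quotient_of_bregman_eq hG hP' hQ' (hsw.trans hd))).div_const 2
    rw [← hquot] at h
    rw [bregman_eq_of_tendsto h, hd, EReal.coe_eq_coe_iff, binarySymmetrization,
      binarySymmetrization]
    ring

theorem satisfiesSufficiency_binary_iff {G : (Fin 2 → ℝ) → ℝ} (hG : IsBregmanGenerator 2 G) :
    SatisfiesSufficiency 2 (bregman G) ↔
      ∃ S : (Fin 2 → ℝ) → ℝ, IsBregmanGenerator 2 S ∧ IsSymmetricOnSimplex 2 S ∧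
        ∀ P ∈ probSimplex 2, ∀ Q ∈ probSimplex 2, bregman G P Q = bregman S P Q := by
  constructor
  · intro h
    exact ⟨_, isBregmanGenerator_binarySymmetrization hG,
      isSymmetricOnSimplex_binarySymmetrization G,
      fun P hP Q hQ => bregman_binarySymmetrization hG.convexOn h hP hQ⟩
  · rintro ⟨S, hS, hsym, hGS⟩ P hP Q hQ w hw W hW hsuff
    rw [hGS P hP Q hQ, hGS _ (vecMul_mem_probSimplex hW hP) _ (vecMul_mem_probSimplex hW hQ)]
    exact satisfiesSufficiency_of_symmetric hS.convexOn hsym P hP Q hQ w hw W hW hsuff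

/-- The two-letter form of the propriety of the scoring rule `-ψ`. -/
def IsBinaryProper (ψ : ℝ → ℝ) : Prop :=
  ∀ p p' q q' : ℝ, 0 < p → 0 < p' → 0 < q → 0 < q' → p + p' = q + q' → p + p' < 1 →
    0 ≤ p * (ψ q - ψ p) + p' * (ψ q' - ψ p')

theorem IsBinaryProper.antitoneOn {ψ : ℝ → ℝ} (h : IsBinaryProper ψ) :
    AntitoneOn ψ (Ioo 0 1) := by
  intro q hq p hp hqp
  rcases hqp.eq_or_lt with rfl | hlt
  · exact le_rfl
  obtain ⟨p', hp'⟩ : ∃ p', p' = (1 - p) / 2 := ⟨_, rfl⟩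
  obtain ⟨q', hq'⟩ : ∃ q', q' = p + p' - q := ⟨_, rfl⟩
  have hp1 := hp.2
  have hp'0 : 0 < p' := by linarith
  have hq'0 : p' < q' := by linarith
  have h1 := h p p' q q' hp.1 hp'0 hq.1 (by linarith) (by linarith) (by linarith)
  have h2 := h q q' p p' hq.1 (by linarith) hp.1 hp'0 (by linarith) (by linarith)
  have h3 : 0 ≤ (p * q' - p' * q) * (ψ q - ψ p) := by
    have a1 := mul_nonneg (hp'0.trans hq'0).le h1
    have a2 := mul_nonneg hp'0.le h2
    nlinarith
  have h4 : 0 < p * q' - p' * q := by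
    have := mul_lt_mul'' hlt hq'0 hq.1.le hp'0.le
    nlinarith
  have := nonneg_of_mul_nonneg_right h3 h4
  linarith

theorem AntitoneOn.exists_differentiableAt {ψ : ℝ → ℝ} {a b : ℝ} (h : AntitoneOn ψ (Ioo a b))
    (hab : a < b) : ∃ p ∈ Ioo a b, DifferentiableAt ℝ ψ p := by
  have hae := h.neg.ae_differentiableWithinAt_of_mem
  by_contra! hcon
  have hnull : MeasureTheory.volume (Ioo a b) = 0 := by
    refine MeasureTheory.measure_mono_null ?_ hae
    intro x hx hx'
    have hd := (hx' hx).differentiableAt (Ioo_mem_nhds hx.1 hx.2)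
    exact hcon x hx (by simpa using hd.neg)
  rw [Real.volume_Ioo, ENNReal.ofReal_eq_zero] at hnull
  linarith

/-- Differentiability of a proper `ψ` at one point propagates by reflection. -/
theorem IsBinaryProper.hasDerivAt {ψ : ℝ → ℝ} (h : IsBinaryProper ψ) {p b d : ℝ} (hp : 0 < p)
    (hb : 0 < b) (hpb : p + b < 1) (hd : HasDerivAt ψ d p) : HasDerivAt ψ (p * d / b) b := by
  have hd0 : HasDerivAt (fun x => ψ (p + b - x)) (-d) b := by
    have : HasDerivAt ψ d (p + b - b) := by simpa using hd
    exact (this.comp b ((hasDerivAt_id b).const_sub (p + b))).congr_deriv (by ring)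
  have hu : HasDerivAt (fun x => -(p / b) * (ψ (p + b - x) - ψ p)) (p * d / b) b := by
    exact ((hd0.sub_const (ψ p)).const_mul (-(p / b))).congr_deriv (by ring)
  have hl : HasDerivAt (fun x => -((p + b - x) / x) * (ψ (p + b - x) - ψ p)) (p * d / b) b := by
    have h1 : HasDerivAt (fun x => -((p + b - x) / x)) _ b :=
      (((hasDerivAt_id b).const_sub (p + b)).div (hasDerivAt_id b) hb.ne').neg
    refine (h1.mul (hd0.sub_const (ψ p))).congr_deriv ?_
    simp
    ring
  rw [hasDerivAt_iff_isLittleO] at hu hl ⊢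
  refine (Asymptotics.IsBigO.of_bound' ?_).trans_isLittleO (hu.norm_left.add hl.norm_left)
  filter_upwards [Ioo_mem_nhds hb (show b < p + b by linarith)] with x hx
  have hx0 := hx.1
  have hq : 0 < p + b - x := by linarith [hx.2]
  have h1 := h p b (p + b - x) x hp hb hq hx0 (by ring) hpb
  have h2 := h (p + b - x) x p b hq hx0 hp hb (by ring) (by linarith)
  have hlow : -(p / b) * (ψ (p + b - x) - ψ p) ≤ ψ x - ψ b := by
    have : -(p / b) * (ψ (p + b - x) - ψ p) = -(p * (ψ (p + b - x) - ψ p)) / b := by ring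
    rw [this, div_le_iff₀ hb]
    linarith
  have hupp : ψ x - ψ b ≤ -((p + b - x) / x) * (ψ (p + b - x) - ψ p) := by
    have : -((p + b - x) / x) * (ψ (p + b - x) - ψ p)
        = -((p + b - x) * (ψ (p + b - x) - ψ p)) / x := by ring
    rw [this, le_div_iff₀ hx0]
    linarith
  have he : ψ (p + b - b) - ψ p = 0 := by simp
  simp only [he, mul_zero, sub_zero]
  rw [Real.norm_of_nonneg (add_nonneg (norm_nonneg _) (norm_nonneg _))]
  simp only [Real.norm_eq_abs]
  rw [abs_le]
  constructor
  · have := neg_abs_le (-(p / b) * (ψ (p + b - x) - ψ p) - (x - b) • (p * d / b))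
    have := abs_nonneg (-((p + b - x) / x) * (ψ (p + b - x) - ψ p) - (x - b) • (p * d / b))
    linarith
  · have := abs_nonneg (-(p / b) * (ψ (p + b - x) - ψ p) - (x - b) • (p * d / b))
    have := le_abs_self (-((p + b - x) / x) * (ψ (p + b - x) - ψ p) - (x - b) • (p * d / b))
    linarith

/-- Local proper scoring rules are logarithmic. -/
theorem IsBinaryProper.eq_log {ψ : ℝ → ℝ} (h : IsBinaryProper ψ) :
    ∃ c C : ℝ, 0 ≤ c ∧ ∀ p ∈ Ioo (0 : ℝ) 1, ψ p = C - c * Real.log p := by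
  have hanti := h.antitoneOn
  have hex : ∀ ε ∈ Ioc (0 : ℝ) 1, ∃ p ∈ Ioo 0 ε, DifferentiableAt ℝ ψ p := fun ε hε =>
    (hanti.mono (Ioo_subset_Ioo_right hε.2)).exists_differentiableAt hε.1
  have hderiv : ∃ k : ℝ, ∀ b ∈ Ioo (0 : ℝ) 1, HasDerivAt ψ (k / b) b := by
    obtain ⟨p₀, hp₀, hd₀⟩ := hex (1 / 2) (by norm_num)
    refine ⟨p₀ * deriv ψ p₀, fun b hb => ?_⟩
    have hlt : 0 < min (1 - b) (1 / 2) := lt_min (by linarith [hb.2]) (by norm_num)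
    obtain ⟨p, hp, hd⟩ := hex (min (1 - b) (1 / 2))
      ⟨hlt, (min_le_right _ _).trans (by norm_num)⟩
    have hp1 := hp.2.trans_le (min_le_left _ _)
    have hp2 := hp.2.trans_le (min_le_right _ _)
    have hp02 := hp₀.2
    have e := (h.hasDerivAt hp.1 hp₀.1 (by linarith) hd.hasDerivAt).deriv
    rw [e, mul_div_cancel₀ _ hp₀.1.ne']
    exact h.hasDerivAt hp.1 hb.1 (by linarith) hd.hasDerivAt
  obtain ⟨k, hk⟩ := hderiv
  have hφ : ∀ b ∈ Ioo (0 : ℝ) 1, HasDerivAt (fun x => ψ x - k * Real.log x) 0 b := by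
    intro b hb
    refine ((hk b hb).sub ((Real.hasDerivAt_log hb.1.ne').const_mul k)).congr_deriv ?_
    rw [div_eq_mul_inv, sub_self]
  obtain ⟨C, hC⟩ := isOpen_Ioo.exists_is_const_of_deriv_eq_zero isPreconnected_Ioo
    (fun b hb => (hφ b hb).differentiableAt.differentiableWithinAt)
    (fun b hb => (hφ b hb).deriv)
  refine ⟨-k, C, ?_, fun p hp => by linarith [hC p hp]⟩
  have m1 : (1 / 4 : ℝ) ∈ Ioo (0 : ℝ) 1 := by norm_num
  have m2 : (1 / 2 : ℝ) ∈ Ioo (0 : ℝ) 1 := by norm_num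
  have h1 := hanti m1 m2 (by norm_num)
  have h2 := hC _ m1
  have h3 := hC _ m2
  have h4 : Real.log (1 / 4) < Real.log (1 / 2) := Real.log_lt_log (by norm_num) (by norm_num)
  by_contra! hneg
  nlinarith

/-- Sufficiency for the channel that sends the letter `i` to `j` and forgets which of the other
letters was sent. -/
theorem SatisfiesSufficiency.vertex_le {n : ℕ} {D : (Fin n → ℝ) → (Fin n → ℝ) → EReal}
    (hD : SatisfiesSufficiency n D) {Q Q' : Fin n → ℝ}
    (hQ : Q ∈ probSimplex n) (hQ' : Q' ∈ probSimplex n) {i j : Fin n} (hij : Q i = Q' j)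
    (hlt : Q i < 1) : D (Pi.single j 1) Q' ≤ D (Pi.single i 1) Q := by
  have hne : 1 - Q i ≠ 0 := by linarith
  obtain ⟨R, hR⟩ : ∃ R : Fin n → ℝ, R = fun y => if y = j then 0 else Q' y / (1 - Q i) := ⟨_, rfl⟩
  have hRj : R j = 0 := by simp [hR]
  have hRsum : ∑ y, R y = 1 := by
    have h1 : ∑ y, R y = (∑ y ∈ Finset.univ.erase j, Q' y) / (1 - Q i) := by
      rw [← Finset.add_sum_erase _ _ (Finset.mem_univ j), hRj, zero_add, Finset.sum_div]
      refine Finset.sum_congr rfl fun y hy => ?_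
      simp [hR, Finset.ne_of_mem_erase hy]
    have h2 := Finset.add_sum_erase Finset.univ Q' (Finset.mem_univ j)
    rw [hQ'.2] at h2
    rw [h1, div_eq_one_iff_eq hne]
    linarith
  obtain ⟨W, hWdef⟩ : ∃ W : Matrix (Fin n) (Fin n) ℝ,
      W = fun x y => if x = i then (Pi.single j 1 : Fin n → ℝ) y else R y := ⟨_, rfl⟩
  have hWi : ∀ y, W i y = (Pi.single j 1 : Fin n → ℝ) y := by intro y; simp [hWdef]
  have hWne : ∀ x, x ≠ i → ∀ y, W x y = R y := by intro x hx y; simp [hWdef, hx]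
  have hW : W ∈ Matrix.rowStochastic ℝ (Fin n) := by
    refine Matrix.mem_rowStochastic_iff_sum.2 ⟨fun x y => ?_, fun x => ?_⟩
    · by_cases hx : x = i
      · rw [hx, hWi]; exact (single_mem_stdSimplex ℝ j).1 y
      · rw [hWne x hx, hR]
        by_cases hy : y = j
        · simp [hy]
        · simpa [hy] using div_nonneg (hQ'.1 y) (by linarith)
    · by_cases hx : x = i
      · simp only [hx, hWi]; exact (single_mem_stdSimplex ℝ j).2
      · simp only [hWne x hx, hRsum]
  have hPW : Matrix.vecMul (Pi.single i 1) W = Pi.single j 1 := by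
    ext y
    simp [hWi]
  have hQW : Matrix.vecMul Q W = Q' := by
    ext y
    simp only [Matrix.vecMul, dotProduct]
    rw [← Finset.add_sum_erase _ _ (Finset.mem_univ i), hWi]
    have h1 : ∑ x ∈ Finset.univ.erase i, Q x * W x y = (1 - Q i) * R y := by
      have h2 := Finset.add_sum_erase Finset.univ Q (Finset.mem_univ i)
      rw [hQ.2] at h2
      rw [show 1 - Q i = ∑ x ∈ Finset.univ.erase i, Q x by linarith, Finset.sum_mul]
      exact Finset.sum_congr rfl fun x hx => by rw [hWne x (Finset.ne_of_mem_erase hx)]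
    rw [h1]
    by_cases hy : y = j
    · rw [hy, hRj, hij]; simp
    · simp only [hR, if_neg hy, Pi.single_eq_of_ne hy]
      field_simp
      ring
  have h := hD.le_of_posterior (single_mem_stdSimplex ℝ i) hQ hW (by
    intro x y
    rw [hPW, hQW]
    by_cases hx : x = i
    · rw [hx, hWi]
      by_cases hy : y = j
      · rw [hy]; simp [hij]
      · simp [hy]
    · rw [hWne x hx]
      by_cases hy : y = j
      · rw [hy, hRj]; simp
      · simp [hx, hy])
  rwa [hPW, hQW] at h

/-- Sufficiency for the channel that merges the letter `k` into the letter `j`. -/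
theorem SatisfiesSufficiency.merge_le {n : ℕ} {D : (Fin n → ℝ) → (Fin n → ℝ) → EReal}
    (hD : SatisfiesSufficiency n D) {P Q : Fin n → ℝ} (hP : P ∈ probSimplex n)
    (hQ : Q ∈ probSimplex n) {j k : Fin n} (hjk : j ≠ k) (h : P j * Q k = P k * Q j) :
    D (P + Pi.single j (P k) - Pi.single k (P k)) (Q + Pi.single j (Q k) - Pi.single k (Q k))
      ≤ D P Q := by
  obtain ⟨W, hWdef⟩ : ∃ W : Matrix (Fin n) (Fin n) ℝ,
      W = fun x => if x = k then (Pi.single j 1 : Fin n → ℝ) else Pi.single x 1 := ⟨_, rfl⟩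
  have hWk : W k = Pi.single j 1 := by simp [hWdef]
  have hWne : ∀ x, x ≠ k → W x = Pi.single x 1 := by intro x hx; simp [hWdef, hx]
  have hW : W ∈ Matrix.rowStochastic ℝ (Fin n) := by
    refine Matrix.mem_rowStochastic_iff_sum.2 ⟨fun x y => ?_, fun x => ?_⟩
    · by_cases hx : x = k
      · rw [hx, hWk]; exact (single_mem_stdSimplex ℝ j).1 y
      · rw [hWne x hx]; exact (single_mem_stdSimplex ℝ x).1 y
    · by_cases hx : x = k
      · rw [hx, hWk]; exact (single_mem_stdSimplex ℝ j).2
      · rw [hWne x hx]; exact (single_mem_stdSimplex ℝ x).2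
  have hvec : ∀ R : Fin n → ℝ,
      Matrix.vecMul R W = R + Pi.single j (R k) - Pi.single k (R k) := by
    intro R
    ext y
    simp only [Matrix.vecMul, dotProduct, Pi.add_apply, Pi.sub_apply]
    rw [← Finset.add_sum_erase _ _ (Finset.mem_univ k), hWk]
    have h1 : ∑ x ∈ Finset.univ.erase k, R x * W x y
        = (∑ x, R x * (Pi.single x 1 : Fin n → ℝ) y) - R k * (Pi.single k 1 : Fin n → ℝ) y := by
      rw [← Finset.add_sum_erase _ _ (Finset.mem_univ k), add_sub_cancel_left]
      exact Finset.sum_congr rfl fun x hx => by rw [hWne x (Finset.ne_of_mem_erase hx)]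
    have h2 : ∑ x, R x * (Pi.single x 1 : Fin n → ℝ) y = R y := by
      simp [Pi.single_apply]
    have h3 : ∀ l, R k * (Pi.single l 1 : Fin n → ℝ) y = (Pi.single l (R k) : Fin n → ℝ) y := by
      intro l; simp [Pi.single_apply]
    rw [h1, h2, h3, h3]
    ring
  have := hD.le_of_posterior hP hQ hW (by
    intro x y
    rw [hvec, hvec]
    by_cases hx : x = k
    · rw [hx, hWk]
      by_cases hy : y = j
      · subst hy
        simp [hjk]
        linear_combination -h
      · simp [hy]
    · rw [hWne x hx]
      by_cases hy : y = x
      · subst hy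
        by_cases hyj : y = j
        · subst hyj
          simp [hjk]
          linear_combination h
        · simp [hyj, hx, mul_comm]
      · simp [hy])
  rwa [hvec, hvec] at this

/-- The law putting mass `p` on `i`, `p'` on `j` and sharing the rest equally. -/
noncomputable def twoLetterLaw {n : ℕ} (i j : Fin n) (p p' : ℝ) (k : Fin n) : ℝ :=
  if k = i then p else if k = j then p' else (1 - p - p') / (n - 2)

theorem sum_of_pair {n : ℕ} {i j : Fin n} (hij : i ≠ j) (f : Fin n → ℝ) :
    ∑ k, f k = f i + f j + ∑ k ∈ (Finset.univ.erase i).erase j, f k := by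
  rw [← Finset.add_sum_erase _ _ (Finset.mem_univ i),
    ← Finset.add_sum_erase _ _ (show j ∈ Finset.univ.erase i by simp [hij.symm]), add_assoc]

theorem twoLetterLaw_mem {n : ℕ} (hn : 3 ≤ n) {i j : Fin n} (hij : i ≠ j) {p p' : ℝ} (hp : 0 < p)
    (hp' : 0 < p') (hpp : p + p' < 1) : twoLetterLaw i j p p' ∈ probSimplexPos n := by
  have hn' : (0 : ℝ) < n - 2 := by
    have : (3 : ℝ) ≤ n := by exact_mod_cast hn
    linarith
  have hpos : ∀ k, 0 < twoLetterLaw i j p p' k := by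
    intro k
    unfold twoLetterLaw
    split_ifs
    · exact hp
    · exact hp'
    · exact div_pos (by linarith) hn'
  refine ⟨⟨fun k => (hpos k).le, ?_⟩, hpos⟩
  rw [sum_of_pair hij]
  have : ∑ k ∈ (Finset.univ.erase i).erase j, twoLetterLaw i j p p' k
      = ∑ k ∈ (Finset.univ.erase i).erase j, (1 - p - p') / (n - 2) := by
    refine Finset.sum_congr rfl fun k hk => ?_
    simp only [Finset.mem_erase] at hk
    simp [twoLetterLaw, hk.1, hk.2.1]
  rw [this, Finset.sum_const, Finset.card_erase_of_mem (by simp [hij.symm]),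
    Finset.card_erase_of_mem (Finset.mem_univ _), Finset.card_univ, Fintype.card_fin, nsmul_eq_mul]
  have hc : ((n - 1 - 1 : ℕ) : ℝ) = n - 2 := by
    rw [Nat.sub_sub, Nat.cast_sub (by omega)]; norm_num
  rw [hc]
  simp only [twoLetterLaw, if_true, if_neg hij.symm]
  field_simp
  ring

theorem probSimplex_le_one {n : ℕ} {P : Fin n → ℝ} (hP : P ∈ probSimplex n) (i : Fin n) :
    P i ≤ 1 := by
  rw [← hP.2]
  exact Finset.single_le_sum (fun k _ => hP.1 k) (Finset.mem_univ i)

theorem eq_single_of_eq_one {n : ℕ} {P : Fin n → ℝ} (hP : P ∈ probSimplex n) {i : Fin n}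
    (hi : P i = 1) : P = Pi.single i 1 := by
  have h := Finset.add_sum_erase Finset.univ P (Finset.mem_univ i)
  rw [hP.2, hi] at h
  have h0 := (Finset.sum_eq_zero_iff_of_nonneg (s := Finset.univ.erase i)
    (fun k _ => hP.1 k)).1 (by linarith)
  ext k
  by_cases hk : k = i
  · rw [hk, hi]; simp
  · rw [h0 k (by simp [hk])]; simp [hk]

theorem probSimplexPos_lt_one {n : ℕ} (hn : 2 ≤ n) {P : Fin n → ℝ} (hP : P ∈ probSimplexPos n)
    (i : Fin n) : P i < 1 := by
  refine lt_of_le_of_ne (probSimplex_le_one hP.1 i) fun h => ?_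
  have : Nontrivial (Fin n) := Fin.nontrivial_iff_two_le.2 hn
  obtain ⟨k, hk⟩ := exists_ne i
  have := hP.2 k
  rw [eq_single_of_eq_one hP.1 h, Pi.single_eq_of_ne hk] at this
  exact lt_irrefl _ this

/-- Under sufficiency, the divergence from a vertex is a function of the probability of that
vertex alone. -/
theorem exists_vertex_profile {n : ℕ} (hn : 3 ≤ n) {G : (Fin n → ℝ) → ℝ}
    (hG : IsBregmanGenerator n G) (hD : SatisfiesSufficiency n (bregman G)) :
    ∃ ψ : ℝ → ℝ, ∀ Q ∈ probSimplex n, ∀ i, 0 < Q i → Q i < 1 →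
      bregman G (Pi.single i 1) Q = (ψ (Q i) : EReal) := by
  have hij : (⟨0, by omega⟩ : Fin n) ≠ ⟨1, by omega⟩ := by simp
  set i₀ : Fin n := ⟨0, by omega⟩
  set i₁ : Fin n := ⟨1, by omega⟩
  have hreal : ∀ q ∈ Ioo (0 : ℝ) 1, ∃ d : ℝ, ∀ Q ∈ probSimplex n, ∀ i, Q i = q →
      bregman G (Pi.single i 1) Q = (d : EReal) := by
    intro q hq
    have hR := twoLetterLaw_mem hn hij hq.1 (show 0 < (1 - q) / 2 by linarith [hq.2])
      (by linarith [hq.2])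
    have hRi : twoLetterLaw i₀ i₁ q ((1 - q) / 2) i₀ = q := by simp [twoLetterLaw]
    have hval := bregman_eq (single_mem_stdSimplex ℝ i₀) hR.1
      (hG.differentiable _ hR).hasFDerivWithinAt
    refine ⟨_, fun Q hQ i hi => Eq.trans (le_antisymm ?_ ?_) hval⟩
    · exact SatisfiesSufficiency.vertex_le hD hR.1 hQ (by rw [hRi, hi]) (by rw [hRi]; exact hq.2)
    · exact SatisfiesSufficiency.vertex_le hD hQ hR.1 (by rw [hRi, hi]) (by rw [hi]; exact hq.2)
  choose! ψ hψ using hreal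
  exact ⟨ψ, fun Q hQ i h0 h1 => hψ (Q i) ⟨h0, h1⟩ Q hQ i rfl⟩

theorem sum_smul_single {n : ℕ} (P : Fin n → ℝ) :
    ∑ i, P i • (Pi.single i 1 : Fin n → ℝ) = P := by
  ext k
  simp [Finset.sum_apply, Pi.single_apply]

theorem bregman_eq_of_vertex_profile {n : ℕ} (hn : 3 ≤ n) {G : (Fin n → ℝ) → ℝ}
    (hG : IsBregmanGenerator n G) {ψ : ℝ → ℝ}
    (hψ : ∀ Q ∈ probSimplex n, ∀ i, 0 < Q i → Q i < 1 →
      bregman G (Pi.single i 1) Q = (ψ (Q i) : EReal))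
    {P Q : Fin n → ℝ} (hP : P ∈ probSimplex n) (hQ : Q ∈ probSimplexPos n) :
    bregman G P Q = ((G P - ∑ i, P i * (G (Pi.single i 1) - ψ (Q i)) : ℝ) : EReal) := by
  obtain ⟨G', hG'⟩ := hG.differentiable Q hQ
  rw [bregman_eq hP hQ.1 hG', EReal.coe_eq_coe_iff]
  have h1 : ∀ i, G (Pi.single i 1) - ψ (Q i) = G Q + G' (Pi.single i 1) - G' Q := by
    intro i
    have h := hψ Q hQ.1 i (hQ.2 i) (probSimplexPos_lt_one (by omega) hQ i)
    rw [bregman_eq (single_mem_stdSimplex ℝ i) hQ.1 hG', EReal.coe_eq_coe_iff, map_sub] at h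
    linarith
  have h2 : ∑ i, P i * G' (Pi.single i 1) = G' P := by
    conv_rhs => rw [← sum_smul_single P, map_sum]
    simp only [map_smul, smul_eq_mul]
  simp only [h1, mul_sub, mul_add, Finset.sum_sub_distrib, Finset.sum_add_distrib, h2,
    ← Finset.sum_mul, hP.2, map_sub]
  ring

theorem isBinaryProper_of_vertex_profile {n : ℕ} (hn : 3 ≤ n) {G : (Fin n → ℝ) → ℝ}
    (hG : IsBregmanGenerator n G) {ψ : ℝ → ℝ}
    (hψ : ∀ Q ∈ probSimplex n, ∀ i, 0 < Q i → Q i < 1 →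
      bregman G (Pi.single i 1) Q = (ψ (Q i) : EReal)) : IsBinaryProper ψ := by
  intro p p' q q' hp hp' hq hq' hsum hlt
  have hij : (⟨0, by omega⟩ : Fin n) ≠ ⟨1, by omega⟩ := by simp
  set i : Fin n := ⟨0, by omega⟩
  set j : Fin n := ⟨1, by omega⟩
  have hP := twoLetterLaw_mem hn hij hp hp' hlt
  have hQ := twoLetterLaw_mem hn hij hq hq' (hsum ▸ hlt)
  have h1 := bregman_nonneg hG.convexOn hP.1 hQ.1
  have h2 := bregman_self G (twoLetterLaw i j p p')
  rw [bregman_eq_of_vertex_profile hn hG hψ hP.1 hQ] at h1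
  rw [bregman_eq_of_vertex_profile hn hG hψ hP.1 hP] at h2
  rw [EReal.coe_nonneg] at h1
  rw [EReal.coe_eq_zero] at h2
  have h3 : 0 ≤ ∑ k, twoLetterLaw i j p p' k *
      (ψ (twoLetterLaw i j q q' k) - ψ (twoLetterLaw i j p p' k)) := by
    simp only [mul_sub, Finset.sum_sub_distrib] at h1 h2 ⊢
    linarith
  rw [sum_of_pair hij] at h3
  have h4 : ∑ k ∈ (Finset.univ.erase i).erase j, twoLetterLaw i j p p' k *
      (ψ (twoLetterLaw i j q q' k) - ψ (twoLetterLaw i j p p' k)) = 0 := by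
    refine Finset.sum_eq_zero fun k hk => ?_
    simp only [Finset.mem_erase] at hk
    have : 1 - p - p' = 1 - q - q' := by linarith
    simp [twoLetterLaw, hk.1, hk.2.1, this]
  rw [h4] at h3
  simpa [twoLetterLaw, hij.symm] using h3

/-- The tangents at interior points bound `G` below on the whole simplex. -/
theorem log_score_le {n : ℕ} (hn : 3 ≤ n) {G : (Fin n → ℝ) → ℝ}
    (hG : IsBregmanGenerator n G) {ψ : ℝ → ℝ}
    (hψ : ∀ Q ∈ probSimplex n, ∀ i, 0 < Q i → Q i < 1 →
      bregman G (Pi.single i 1) Q = (ψ (Q i) : EReal))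
    {c C : ℝ} (hlog : ∀ p ∈ Ioo (0 : ℝ) 1, ψ p = C - c * Real.log p)
    {P : Fin n → ℝ} (hP : P ∈ probSimplex n) :
    ∑ i, P i * (G (Pi.single i 1) - (C - c * Real.log (P i))) ≤ G P := by
  have hn0 : (0 : ℝ) < n := by exact_mod_cast (by omega : 0 < n)
  have hQ : ∀ t ∈ Ioo (0 : ℝ) 1, (fun i => (1 - t) * P i + t * (1 / n)) ∈ probSimplexPos n := by
    intro t ht
    have hpos : ∀ i, 0 < (1 - t) * P i + t * (1 / n) := fun i =>
      add_pos_of_nonneg_of_pos (mul_nonneg (by linarith [ht.2]) (hP.1 i))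
        (mul_pos ht.1 (by positivity))
    refine ⟨⟨fun i => (hpos i).le, ?_⟩, hpos⟩
    rw [Finset.sum_add_distrib, ← Finset.mul_sum, hP.2]
    simp only [Finset.sum_const, Finset.card_univ, Fintype.card_fin, nsmul_eq_mul]
    field_simp
    ring
  have hle : ∀ᶠ t : ℝ in 𝓝[>] 0, ∑ i, P i * (G (Pi.single i 1)
      - (C - c * Real.log ((1 - t) * P i + t * (1 / n)))) ≤ G P := by
    filter_upwards [Ioo_mem_nhdsGT (zero_lt_one (α := ℝ))] with t ht
    have h := bregman_nonneg hG.convexOn hP (hQ t ht).1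
    rw [bregman_eq_of_vertex_profile hn hG hψ hP (hQ t ht), EReal.coe_nonneg] at h
    have he : ∀ i, ψ ((1 - t) * P i + t * (1 / n))
        = C - c * Real.log ((1 - t) * P i + t * (1 / n)) := fun i =>
      hlog _ ⟨(hQ t ht).2 i, probSimplexPos_lt_one (by omega) (hQ t ht) i⟩
    simp only [he] at h
    linarith
  refine le_of_tendsto ?_ hle
  refine tendsto_finsetSum _ fun i _ => ?_
  by_cases hi : P i = 0
  · simp [hi]
  · refine Tendsto.const_mul _ (Tendsto.const_sub _ (Tendsto.const_sub _ (Tendsto.const_mul _ ?_)))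
    have hcont : ContinuousAt (fun t : ℝ => Real.log ((1 - t) * P i + t * (1 / n))) 0 :=
      ContinuousAt.log (by fun_prop) (by simpa using hi)
    have := hcont.tendsto.mono_left (nhdsWithin_le_nhds (s := Ioi 0))
    simpa using this

/-- Away from the vertices, sublinearity of the directional derivatives bounds `G` above. -/
theorem le_log_score {n : ℕ} {G : (Fin n → ℝ) → ℝ} (hG : ConvexOn ℝ (probSimplex n) G) {ψ : ℝ → ℝ}
    (hψ : ∀ Q ∈ probSimplex n, ∀ i, 0 < Q i → Q i < 1 →
      bregman G (Pi.single i 1) Q = (ψ (Q i) : EReal))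
    {Q : Fin n → ℝ} (hQ : Q ∈ probSimplex n) (hlt : ∀ i, Q i < 1) :
    G Q ≤ ∑ i, Q i * (G (Pi.single i 1) - ψ (Q i)) := by
  have hlim : Tendsto (fun t : ℝ => ∑ i, Q i *
      ((G (Q + t • ((Pi.single i 1 : Fin n → ℝ) - Q)) - G Q) / t)) (𝓝[>] 0)
      (𝓝 (∑ i, Q i * (G (Pi.single i 1) - G Q - ψ (Q i)))) := by
    refine tendsto_finsetSum _ fun i _ => ?_
    rcases (hQ.1 i).eq_or_lt with hi | hi
    · simp [← hi]
    · exact (tendsto_quotient_of_bregman_eq hG (single_mem_stdSimplex ℝ i) hQ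
        (hψ Q hQ i hi (hlt i))).const_mul _
  have hnn : 0 ≤ ∑ i, Q i * (G (Pi.single i 1) - G Q - ψ (Q i)) := by
    refine ge_of_tendsto hlim ?_
    filter_upwards [Ioc_mem_nhdsGT (zero_lt_one (α := ℝ))] with t ht
    have h := hG.map_sum_le (t := Finset.univ) (w := Q)
      (p := fun i => Q + t • ((Pi.single i 1 : Fin n → ℝ) - Q)) (fun i _ => hQ.1 i) hQ.2
      (fun i _ => (convex_stdSimplex ℝ (Fin n)).add_smul_sub_mem hQ (single_mem_stdSimplex ℝ i)
        ⟨ht.1.le, ht.2⟩)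
    have he : ∑ i, Q i • (Q + t • ((Pi.single i 1 : Fin n → ℝ) - Q)) = Q := by
      have : ∀ i, Q i • (Q + t • ((Pi.single i 1 : Fin n → ℝ) - Q))
          = Q i • ((1 - t) • Q) + t • (Q i • (Pi.single i 1 : Fin n → ℝ)) := by
        intro i; ext k; simp; ring
      simp only [this, Finset.sum_add_distrib, ← Finset.smul_sum, ← Finset.sum_smul,
        sum_smul_single, hQ.2]
      ext k; simp; ring
    rw [he] at h
    have h2 : ∑ i, Q i * ((G (Q + t • ((Pi.single i 1 : Fin n → ℝ) - Q)) - G Q) / t)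
        = (∑ i, Q i • G (Q + t • ((Pi.single i 1 : Fin n → ℝ) - Q)) - G Q) / t := by
      simp only [smul_eq_mul, mul_div_assoc', ← Finset.sum_div, mul_sub, Finset.sum_sub_distrib,
        ← Finset.sum_mul, hQ.2, one_mul]
    rw [h2]
    exact div_nonneg (sub_nonneg.2 h) ht.1.le
  simp only [mul_sub, Finset.sum_sub_distrib, ← Finset.sum_mul, hQ.2, one_mul] at hnn ⊢
  linarith

/-- Under sufficiency, `G` is an affine function plus a multiple of the negative entropy. -/
theorem exists_eq_affine_add_entropy {n : ℕ} (hn : 3 ≤ n) {G : (Fin n → ℝ) → ℝ}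
    (hG : IsBregmanGenerator n G) (hD : SatisfiesSufficiency n (bregman G)) :
    ∃ c : ℝ, 0 ≤ c ∧ ∀ P ∈ probSimplex n,
      G P = ∑ i, P i * G (Pi.single i 1) + c * ∑ i, P i * Real.log (P i) := by
  obtain ⟨ψ, hψ⟩ := exists_vertex_profile hn hG hD
  obtain ⟨c, C, hc, hlog⟩ := (isBinaryProper_of_vertex_profile hn hG hψ).eq_log
  have hscore : ∀ P ∈ probSimplex n, ∑ i, P i * (G (Pi.single i 1) - (C - c * Real.log (P i)))
      = ∑ i, P i * G (Pi.single i 1) + c * ∑ i, P i * Real.log (P i) - C := by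
    intro P hP
    simp only [mul_sub, Finset.sum_sub_distrib, ← Finset.sum_mul, hP.2, Finset.mul_sum]
    have : ∀ i, P i * (c * Real.log (P i)) = c * (P i * Real.log (P i)) := fun i => by ring
    simp only [this]
    ring
  have heq : ∀ P ∈ probSimplex n, (∀ i, P i < 1) →
      G P = ∑ i, P i * G (Pi.single i 1) + c * ∑ i, P i * Real.log (P i) - C := by
    intro P hP hlt
    rw [← hscore P hP]
    refine le_antisymm ((le_log_score hG.convexOn hψ hP hlt).trans_eq ?_)
      (log_score_le hn hG hψ hlog hP)
    refine Finset.sum_congr rfl fun i _ => ?_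
    rcases (hP.1 i).eq_or_lt with hi | hi
    · simp [← hi]
    · rw [hlog _ ⟨hi, hlt i⟩]
  have hij : (⟨0, by omega⟩ : Fin n) ≠ ⟨1, by omega⟩ := by simp
  set i : Fin n := ⟨0, by omega⟩
  set j : Fin n := ⟨1, by omega⟩
  have hC0 : 0 ≤ C := by
    have h := log_score_le hn hG hψ hlog (single_mem_stdSimplex ℝ i)
    rw [hscore _ (single_mem_stdSimplex ℝ i)] at h
    simpa [Pi.single_apply] using h
  have hC1 : C ≤ 0 := by
    obtain ⟨P, hPdef⟩ : ∃ P : Fin n → ℝ, P = Pi.single i (1 / 2) + Pi.single j (1 / 2) := ⟨_, rfl⟩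
    have hPi : P i = 1 / 2 := by simp [hPdef, hij]
    have hPj : P j = 1 / 2 := by simp [hPdef, hij.symm]
    have hPk : ∀ k, k ≠ i → k ≠ j → P k = 0 := by intro k h1 h2; simp [hPdef, h1, h2]
    have hcases : ∀ k, P k = 1 / 2 ∨ P k = 0 := by
      intro k
      by_cases h1 : k = i
      · left; rw [h1, hPi]
      · by_cases h2 : k = j
        · left; rw [h2, hPj]
        · right; exact hPk k h1 h2
    have hsum : ∀ f : Fin n → ℝ, ∑ k, P k * f k = (f i + f j) / 2 := by
      intro f
      rw [sum_of_pair hij, hPi, hPj, Finset.sum_eq_zero]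
      · ring
      · intro k hk
        simp only [Finset.mem_erase] at hk
        rw [hPk k hk.2.1 hk.1, zero_mul]
    have hP : P ∈ probSimplex n := by
      refine ⟨fun k => ?_, ?_⟩
      · rcases hcases k with h | h <;> rw [h] <;> norm_num
      · have := hsum fun _ => 1
        simpa using this
    have hPlt : ∀ k, P k < 1 := by
      intro k; rcases hcases k with h | h <;> rw [h] <;> norm_num
    have hQ := twoLetterLaw_mem hn hij (show (0 : ℝ) < 1 / 4 by norm_num)
      (show (0 : ℝ) < 1 / 4 by norm_num) (by norm_num)
    obtain ⟨Q, hQdef⟩ : ∃ Q, Q = twoLetterLaw i j (1 / 4) (1 / 4) := ⟨_, rfl⟩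
    rw [← hQdef] at hQ
    have hQi : Q i = 1 / 4 := by simp [hQdef, twoLetterLaw]
    have hQj : Q j = 1 / 4 := by simp [hQdef, twoLetterLaw, hij.symm]
    have hmerge := hD.merge_le hP hQ.1 hij (by rw [hPi, hPj, hQi, hQj])
    have hP' : P + Pi.single i (P j) - Pi.single j (P j) = Pi.single i 1 := by
      rw [hPj]
      ext k
      by_cases h1 : k = i
      · subst h1; simp [hPi, hij]; norm_num
      · by_cases h2 : k = j
        · subst h2; simp [hPj, hij.symm]
        · simp [h1, h2, hPk k h1 h2]
    have hQ' : Q + Pi.single i (Q j) - Pi.single j (Q j) ∈ probSimplex n := by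
      refine ⟨fun k => ?_, ?_⟩
      · by_cases h1 : k = i
        · subst h1; simp [hQi, hQj, hij]
        · by_cases h2 : k = j
          · subst h2; simp [hij.symm]
          · simpa [h1, h2] using hQ.1.1 k
      · simp [Finset.sum_add_distrib, Finset.sum_sub_distrib, hQ.1.2]
    have hQ'i : (Q + Pi.single i (Q j) - Pi.single j (Q j) : Fin n → ℝ) i = 1 / 2 := by
      simp [hQi, hQj, hij]; norm_num
    rw [hP', hψ _ hQ' i (by rw [hQ'i]; norm_num) (by rw [hQ'i]; norm_num), hQ'i,
      bregman_eq_of_vertex_profile hn hG hψ hP hQ, EReal.coe_le_coe_iff, heq P hP hPlt,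
      hsum, hsum, hsum, hPi, hPj, hQi, hQj, hlog _ (by norm_num), hlog _ (by norm_num)] at hmerge
    have h4 : Real.log (1 / 4) = Real.log (1 / 2) + Real.log (1 / 2) := by
      rw [← Real.log_mul (by norm_num) (by norm_num)]; norm_num
    rw [h4] at hmerge
    linarith
  have hC : C = 0 := le_antisymm hC1 hC0
  refine ⟨c, hc, fun P hP => ?_⟩
  by_cases hv : ∃ k, P k = 1
  · obtain ⟨k, hk⟩ := hv
    rw [eq_single_of_eq_one hP hk]
    simp [Pi.single_apply]
  · push Not at hv
    rw [heq P hP fun k => lt_of_le_of_ne (probSimplex_le_one hP k) (hv k), hC, sub_zero]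

theorem mul_log_quotient_le {p q t : ℝ} (hp : 0 ≤ p) (hq : 0 ≤ q) (ht : t ∈ Ioc (0 : ℝ) 1) :
    ((q + t * (p - q)) * Real.log (q + t * (p - q)) - q * Real.log q) / t
      ≤ p * Real.log p - q * Real.log q := by
  rw [div_le_iff₀ ht.1]
  have h := Real.convexOn_mul_log.2 (mem_Ici.2 hq) (mem_Ici.2 hp) (sub_nonneg.2 ht.2) ht.1.le
    (by ring)
  simp only [smul_eq_mul] at h
  rw [show (1 - t) * q + t * p = q + t * (p - q) by ring] at h
  linarith

theorem tendsto_mul_log_quotient {p q : ℝ} (h : q = 0 → p = 0) :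
    Tendsto (fun t : ℝ => ((q + t * (p - q)) * Real.log (q + t * (p - q)) - q * Real.log q) / t)
      (𝓝[>] 0) (𝓝 ((Real.log q + 1) * (p - q))) := by
  by_cases hq : q = 0
  · simp [hq, h hq]
  have hd : HasDerivAt (fun t : ℝ => (q + t * (p - q)) * Real.log (q + t * (p - q)))
      ((Real.log q + 1) * (p - q)) 0 := by
    have h1 : HasDerivAt (fun t : ℝ => q + t * (p - q)) (p - q) 0 := by
      exact (((hasDerivAt_id (0 : ℝ)).mul_const (p - q)).const_add q).congr_deriv (by ring)
    have h2 : HasDerivAt (fun x => x * Real.log x) (Real.log q + 1) (q + 0 * (p - q)) := by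
      simpa using Real.hasDerivAt_mul_log hq
    exact h2.comp (0 : ℝ) h1
  have := hd.hasDerivWithinAt (s := Ioi 0)
  rw [hasDerivWithinAt_iff_tendsto_slope' (by simp)] at this
  refine this.congr fun t => ?_
  simp [slope_def_field]

/-- The Bregman divergence of an affine function plus a multiple of the negative entropy. -/
theorem bregman_affine_add_entropy {n : ℕ} {G : (Fin n → ℝ) → ℝ} {c : ℝ} (hc : 0 ≤ c)
    {g : Fin n → ℝ}
    (hG : ∀ P ∈ probSimplex n, G P = ∑ i, P i * g i + c * ∑ i, P i * Real.log (P i))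
    {P Q : Fin n → ℝ} (hP : P ∈ probSimplex n) (hQ : Q ∈ probSimplex n) :
    bregman G P Q = (c : EReal) * klDivergence P Q := by
  have hquot : (fun t : ℝ => ∑ i, (P i - Q i) * g i + c * ∑ i,
      ((Q i + t * (P i - Q i)) * Real.log (Q i + t * (P i - Q i)) - Q i * Real.log (Q i)) / t)
      =ᶠ[𝓝[>] 0] fun t : ℝ => (G (Q + t • (P - Q)) - G Q) / t := by
    filter_upwards [Ioc_mem_nhdsGT (zero_lt_one (α := ℝ))] with t ht
    have ht0 := ht.1.ne'
    rw [hG Q hQ, hG _ ((convex_stdSimplex ℝ (Fin n)).add_smul_sub_mem hQ hP ⟨ht.1.le, ht.2⟩)]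
    simp only [Pi.add_apply, Pi.smul_apply, Pi.sub_apply, smul_eq_mul]
    rw [← Finset.sum_div, Finset.sum_sub_distrib]
    have : ∑ i, (Q i + t * (P i - Q i)) * g i = ∑ i, Q i * g i + t * ∑ i, (P i - Q i) * g i := by
      rw [Finset.mul_sum, ← Finset.sum_add_distrib]
      exact Finset.sum_congr rfl fun i _ => by ring
    rw [this]
    field_simp
    ring
  by_cases hac : ∀ i, Q i = 0 → P i = 0
  · have hlim : Tendsto (fun t : ℝ => (G (Q + t • (P - Q)) - G Q) / t) (𝓝[>] 0)
        (𝓝 (∑ i, (P i - Q i) * g i + c * ∑ i, (Real.log (Q i) + 1) * (P i - Q i))) :=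
      ((tendsto_finsetSum _ fun i _ => tendsto_mul_log_quotient (hac i)).const_mul c |>.const_add
        _).congr' hquot
    rw [bregman_eq_of_tendsto hlim, klDivergence, if_pos hac, ← EReal.coe_mul,
      EReal.coe_eq_coe_iff, hG P hP, hG Q hQ]
    have h1 : ∑ i, P i * Real.log (P i / Q i)
        = ∑ i, P i * Real.log (P i) - ∑ i, P i * Real.log (Q i) := by
      rw [← Finset.sum_sub_distrib]
      refine Finset.sum_congr rfl fun i _ => ?_
      by_cases hi : P i = 0
      · simp [hi]
      · rw [Real.log_div hi (fun h => hi (hac i h)), mul_sub]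
    have h2 : ∑ i, (Real.log (Q i) + 1) * (P i - Q i)
        = ∑ i, P i * Real.log (Q i) - ∑ i, Q i * Real.log (Q i) + (∑ i, P i - ∑ i, Q i) := by
      simp only [← Finset.sum_sub_distrib, ← Finset.sum_add_distrib]
      exact Finset.sum_congr rfl fun i _ => by ring
    rw [h1, h2, hP.2, hQ.2]
    simp only [sub_mul, Finset.sum_sub_distrib]
    ring
  · rw [klDivergence, if_neg hac]
    rcases hc.eq_or_lt with rfl | hc
    · have hlim : Tendsto (fun t : ℝ => (G (Q + t • (P - Q)) - G Q) / t) (𝓝[>] 0)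
          (𝓝 (∑ i, (P i - Q i) * g i)) := by
        refine Tendsto.congr' hquot ?_
        simp
      rw [bregman_eq_of_tendsto hlim, hG P hP, hG Q hQ]
      simp only [sub_mul, Finset.sum_sub_distrib]
      simp
    · rw [EReal.coe_mul_top_of_pos hc]
      apply bregman_eq_top_of_tendsto
      refine Tendsto.congr' hquot ?_
      push Not at hac
      obtain ⟨k, hQk, hPk⟩ := hac
      have hPk0 : 0 < P k := lt_of_le_of_ne (hP.1 k) hPk.symm
      refine tendsto_atBot_add_const_left _ _ (Tendsto.const_mul_atBot hc ?_)
      have hbound : ∀ᶠ t : ℝ in 𝓝[>] 0, ∑ i, ((Q i + t * (P i - Q i)) *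
          Real.log (Q i + t * (P i - Q i)) - Q i * Real.log (Q i)) / t ≤ P k * Real.log (t * P k)
            + ∑ i ∈ Finset.univ.erase k, (P i * Real.log (P i) - Q i * Real.log (Q i)) := by
        filter_upwards [Ioc_mem_nhdsGT (zero_lt_one (α := ℝ))] with t ht
        rw [← Finset.add_sum_erase _ _ (Finset.mem_univ k)]
        refine add_le_add (le_of_eq ?_)
          (Finset.sum_le_sum fun i _ => mul_log_quotient_le (hP.1 i) (hQ.1 i) ht)
        rw [hQk]
        have := ht.1.ne'
        simp only [zero_add, sub_zero, zero_mul]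
        field_simp
      refine tendsto_atBot_mono' _ hbound (tendsto_atBot_add_const_right _ _
        (Tendsto.const_mul_atBot hPk0 (Real.tendsto_log_nhdsGT_zero.comp ?_)))
      refine tendsto_nhdsWithin_iff.2 ⟨?_, ?_⟩
      · have : Tendsto (fun t : ℝ => t * P k) (𝓝 0) (𝓝 (0 * P k)) := tendsto_id.mul_const _
        rw [zero_mul] at this
        exact this.mono_left nhdsWithin_le_nhds
      · filter_upwards [self_mem_nhdsWithin] with t ht
        exact mul_pos ht hPk0

theorem theorem4 :
    (∀ n : ℕ, 3 ≤ n → ∀ G : (Fin n → ℝ) → ℝ, IsBregmanGenerator n G →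
      SatisfiesSufficiency n (bregman G) →
        ∃ c : ℝ, 0 ≤ c ∧ ∀ P ∈ probSimplex n, ∀ Q ∈ probSimplex n,
          bregman G P Q = (c : EReal) * klDivergence P Q) ∧
    (∀ G : (Fin 2 → ℝ) → ℝ, IsBregmanGenerator 2 G →
      (SatisfiesSufficiency 2 (bregman G) ↔
        ∃ S : (Fin 2 → ℝ) → ℝ, IsBregmanGenerator 2 S ∧ IsSymmetricOnSimplex 2 S ∧
          ∀ P ∈ probSimplex 2, ∀ Q ∈ probSimplex 2, bregman G P Q = bregman S P Q)) := by
  refine ⟨fun n hn G hG hD => ?_, fun G hG => satisfiesSufficiency_binary_iff hG⟩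
  obtain ⟨c, hc, hGc⟩ := exists_eq_affine_add_entropy hn hG hD
  exact ⟨c, hc, fun P hP Q hQ => bregman_affine_add_entropy hc hGc hP hQ⟩
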